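/- Let $X$ be a Banach space over $\mathbb K\in\{\mathbb R,\mathbb C\}$ with closed unit ball $B_X$. For a sequence $(x_k)$ in $X$ put $$\operatorname{ca}(x_k)=\inf_{n\in\mathbb N}\sup\{\|x_k-x_l\| : k,l\ge n\},\qquad \operatorname{cca}(x_k)=\operatorname{ca}\Bigl(\frac1k\sum_{i=1}^k x_i\Bigr),$$ $$\widetilde{\operatorname{cca}}(x_k)=\inf\{\operatorname{cca}(x_{k_n}) : (x_{k_n})\text{ is a subsequence of }(x_k)\},$$ and for a bounded set $A\subset X$ put $$\operatorname{bs}(A)=\sup\{\widetilde{\operatorname{cca}}(x_k) : (x_k)\subset A\},\qquad \operatorname{wbs}(A)=\sup\{\widetilde{\operatorname{cca}}(x_k) : (x_k)\subset A\text{ converges weakly in }X\}.$$ Let $\ell_1$ be the space of absolutely summable $\mathbb K$-valued sequences with its usual norm, and let $c_0$ and $c$ be the spaces of null and of convergent $\mathbb K$-valued sequences, respectively, with the supremum norm. Then: (1) If $X$ contains a linear subspace that is linearly homeomorphic to $\ell_1$, then $\operatorname{bs}(B_X)=2$. In particular, $\operatorname{bs}(B_{\ell_1})=2$; moreover $\operatorname{wbs}(B_{\ell_1})=0$.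 (2) If $X$ is nonreflexive and contains no linear subspace that is linearly homeomorphic to $\ell_1$, then $1\le\operatorname{bs}(B_X)\le 2$. Concretely, $\operatorname{bs}(B_{c_0})=1$, $\operatorname{bs}(B_c)=2$, and $\operatorname{wbs}(B_{c_0})=\operatorname{wbs}(B_c)=0$. -/

import Mathlib

open Filter Topology
open scoped ENNReal ZeroAtInfty BoundedContinuousFunction

namespace BanachSaks

/-- `ca (x_k) = inf_n sup {‖x_k - x_l‖ : k, l ≥ n}`, with values in `[0, ∞]`
(finite for bounded sequences). -/
noncomputable def ca {X : Type*} [NormedAddCommGroup X] (x : ℕ → X) : ℝ≥0∞ :=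
  ⨅ n : ℕ, ⨆ (k : ℕ) (_ : n ≤ k) (l : ℕ) (_ : n ≤ l), ‖x k - x l‖ₑ

/-- The sequence of arithmetic means of `x`. Sequences are indexed from `0`, so the entry of
index `k` is the mean of the first `k + 1` terms. -/
noncomputable def cesaroMeans (𝕜 : Type*) {X : Type*} [RCLike 𝕜] [NormedAddCommGroup X]
    [NormedSpace 𝕜 X] (x : ℕ → X) (k : ℕ) : X :=
  ((k + 1 : ℕ) : 𝕜)⁻¹ • ∑ i ∈ Finset.range (k + 1), x i

/-- `cca (x_k)`: the quantity `ca` of the sequence of arithmetic means. -/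
noncomputable def cca (𝕜 : Type*) {X : Type*} [RCLike 𝕜] [NormedAddCommGroup X]
    [NormedSpace 𝕜 X] (x : ℕ → X) : ℝ≥0∞ :=
  ca (cesaroMeans 𝕜 x)

/-- The infimum of `cca` over all subsequences. -/
noncomputable def ccaTilde (𝕜 : Type*) {X : Type*} [RCLike 𝕜] [NormedAddCommGroup X]
    [NormedSpace 𝕜 X] (x : ℕ → X) : ℝ≥0∞ :=
  ⨅ (φ : ℕ → ℕ) (_ : StrictMono φ), cca 𝕜 (x ∘ φ)

/-- `x` converges weakly to some element of `X`. -/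
def WeaklyConvergent (𝕜 : Type*) {X : Type*} [RCLike 𝕜] [NormedAddCommGroup X]
    [NormedSpace 𝕜 X] (x : ℕ → X) : Prop :=
  ∃ a : X, Tendsto (fun k => toWeakSpace 𝕜 X (x k)) atTop (𝓝 (toWeakSpace 𝕜 X a))

/-- `bs A`: the supremum of `ccaTilde` over all sequences in `A`. -/
noncomputable def bs (𝕜 : Type*) {X : Type*} [RCLike 𝕜] [NormedAddCommGroup X]
    [NormedSpace 𝕜 X] (A : Set X) : ℝ≥0∞ :=
  ⨆ (x : ℕ → X) (_ : ∀ k, x k ∈ A), ccaTilde 𝕜 x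

/-- `wbs A`: the supremum of `ccaTilde` over all sequences in `A` that converge weakly in `X`
(the weak limit need not belong to `A`). -/
noncomputable def wbs (𝕜 : Type*) {X : Type*} [RCLike 𝕜] [NormedAddCommGroup X]
    [NormedSpace 𝕜 X] (A : Set X) : ℝ≥0∞ :=
  ⨆ (x : ℕ → X) (_ : ∀ k, x k ∈ A) (_ : WeaklyConvergent 𝕜 x), ccaTilde 𝕜 x

/-- The space `ℓ₁` of absolutely summable sequences. -/
abbrev EllOne (𝕜 : Type*) [RCLike 𝕜] : Type _ := lp (fun _ : ℕ => 𝕜) 1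

/-- The space `c₀` of null sequences with the supremum norm. On the discrete space `ℕ` every
function is continuous, and vanishing at infinity means tending to `0`. -/
abbrev SeqCZero (𝕜 : Type*) [RCLike 𝕜] : Type _ := C₀(ℕ, 𝕜)

/-- The space `c` of convergent sequences, as a subspace of the bounded sequences
with the supremum norm. -/
def seqC (𝕜 : Type*) [RCLike 𝕜] : Submodule 𝕜 (ℕ →ᵇ 𝕜) where
  carrier := {x | ∃ a : 𝕜, Tendsto (fun n => x n) atTop (𝓝 a)}
  add_mem' := by
    rintro x y ⟨a, ha⟩ ⟨b, hb⟩
    exact ⟨a + b, ha.add hb⟩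
  zero_mem' := ⟨0, tendsto_const_nhds⟩
  smul_mem' := by
    rintro r x ⟨a, ha⟩
    exact ⟨r • a, ha.const_smul r⟩

/-- `X` contains an isomorphic copy of `ℓ₁`: some linear subspace of `X` is linearly
homeomorphic to `ℓ₁`. -/
def ContainsEllOne (𝕜 X : Type*) [RCLike 𝕜] [NormedAddCommGroup X] [NormedSpace 𝕜 X] : Prop :=
  ∃ Y : Submodule 𝕜 X, Nonempty (EllOne 𝕜 ≃L[𝕜] Y)

/-- `X` is reflexive: the canonical embedding into the bidual is onto. -/
def Reflexive (𝕜 X : Type*) [RCLike 𝕜] [NormedAddCommGroup X] [NormedSpace 𝕜 X] : Prop :=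
  Function.Surjective (NormedSpace.inclusionInDoubleDual 𝕜 X)

end BanachSaks

namespace BanachSaks

/-! ### Means, subsequences and the separation criterion. -/

section Basic

variable {X : Type*} [NormedAddCommGroup X]

/-! Means of vectors of the unit ball stay in the ball, which gives the upper bound 2. Lower bounds
need a feature that survives every passage to a subsequence, and two such features occur.

Separation (`le_ccaTilde_of_functionals`): if contractive functionals are near `α` on an initial
segment and near `β` afterwards, an early mean and a much later mean are about `‖β - α‖` apart.
James's sequences in a nonreflexive space give values near 0 and 1, the summing basis of `c₀` gives
0 and 1, and its variant in `c` gives -1 and 1.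

`ℓ₁`-behaviour: by James's distortion theorem a copy of `ℓ₁` contains almost isometric
`ℓ₁`-sequences in the ball. The difference of an early and a late mean has coefficients of `ℓ₁`-norm
close to 2.

The upper bounds in `c₀` and `c` come from a gliding hump: along a subsequence each coordinate is a
small perturbation of a step from 0 to its limit `b`, apart from one term. Means of a step lie on
the segment `[0, b]`, so they differ by at most `‖b‖`; here `‖b‖ ≤ 1` in general, and `b = 0` once a
weak limit is subtracted. In `ℓ₁` the Schur property replaces this argument. -/

lemma ca_le_ofReal {x : ℕ → X} {r : ℝ}
    (h : ∃ n, ∀ k, n ≤ k → ∀ l, n ≤ l → ‖x k - x l‖ ≤ r) : ca x ≤ ENNReal.ofReal r := by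
  obtain ⟨n, hn⟩ := h
  refine iInf_le_of_le n (iSup₂_le fun k hk => iSup₂_le fun l hl => ?_)
  rw [← ofReal_norm]
  exact ENNReal.ofReal_le_ofReal (hn k hk l hl)

lemma ofReal_le_of_forall_lt {c : ℝ} {b : ℝ≥0∞} (h : ∀ r < c, ENNReal.ofReal r ≤ b) :
    ENNReal.ofReal c ≤ b := by
  refine le_of_tendsto (x := 𝓝[<] c) (f := ENNReal.ofReal)
    (ENNReal.continuous_ofReal.continuousWithinAt.tendsto) ?_
  filter_upwards [self_mem_nhdsWithin] with r hr using h r hr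

lemma le_ofReal_of_forall_pos {c : ℝ} {b : ℝ≥0∞}
    (h : ∀ ε > 0, b ≤ ENNReal.ofReal (c + ε)) : b ≤ ENNReal.ofReal c := by
  refine ge_of_tendsto (x := 𝓝[>] c) (f := ENNReal.ofReal)
    (ENNReal.continuous_ofReal.continuousWithinAt.tendsto) ?_
  filter_upwards [self_mem_nhdsWithin] with r hr
  simpa using h (r - c) (sub_pos.2 hr)

lemma ofReal_le_ca {x : ℕ → X} {r : ℝ}
    (h : ∀ n, ∀ s < r, ∃ k, n ≤ k ∧ ∃ l, n ≤ l ∧ s ≤ ‖x k - x l‖) :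
    ENNReal.ofReal r ≤ ca x := by
  refine le_iInf fun n => ofReal_le_of_forall_lt fun s hs => ?_
  obtain ⟨k, hk, l, hl, hkl⟩ := h n s hs
  calc ENNReal.ofReal s ≤ ‖x k - x l‖ₑ := by
        rw [← ofReal_norm]; exact ENNReal.ofReal_le_ofReal hkl
    _ ≤ ⨆ (l : ℕ) (_ : n ≤ l), ‖x k - x l‖ₑ := le_iSup₂ (f := fun l _ => ‖x k - x l‖ₑ) l hl
    _ ≤ _ := le_iSup₂ (f := fun k _ => ⨆ (l : ℕ) (_ : n ≤ l), ‖x k - x l‖ₑ) k hk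

lemma ca_sub_const (x : ℕ → X) (a : X) : ca (fun k => x k - a) = ca x := by
  simp [ca]

variable (𝕜 : Type*) [RCLike 𝕜] [NormedSpace 𝕜 X]

lemma cesaroMeans_const (a : X) (k : ℕ) : cesaroMeans 𝕜 (fun _ => a) k = a := by
  have : ((k + 1 : ℕ) : 𝕜) ≠ 0 := by exact_mod_cast k.succ_ne_zero
  rw [cesaroMeans, Finset.sum_const, Finset.card_range, ← Nat.cast_smul_eq_nsmul 𝕜, smul_smul,
    inv_mul_cancel₀ this, one_smul]

lemma cesaroMeans_sub (x y : ℕ → X) (k : ℕ) :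
    cesaroMeans 𝕜 (fun i => x i - y i) k = cesaroMeans 𝕜 x k - cesaroMeans 𝕜 y k := by
  simp [cesaroMeans, Finset.sum_sub_distrib, smul_sub]

lemma norm_cesaroMeans (x : ℕ → X) (k : ℕ) :
    ‖cesaroMeans 𝕜 x k‖ = ((k : ℝ) + 1)⁻¹ * ‖∑ i ∈ Finset.range (k + 1), x i‖ := by
  rw [cesaroMeans, norm_smul, norm_inv, RCLike.norm_natCast, Nat.cast_succ]

lemma norm_cesaroMeans_le_of_sum {x : ℕ → X} {k : ℕ} {r : ℝ}
    (h : ∑ i ∈ Finset.range (k + 1), ‖x i‖ ≤ ((k : ℝ) + 1) * r) : ‖cesaroMeans 𝕜 x k‖ ≤ r := by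
  rw [norm_cesaroMeans, inv_mul_le_iff₀ (by positivity)]
  exact (norm_sum_le _ _).trans h

lemma norm_cesaroMeans_le {x : ℕ → X} {k : ℕ} {r : ℝ} (h : ∀ i ≤ k, ‖x i‖ ≤ r) :
    ‖cesaroMeans 𝕜 x k‖ ≤ r := by
  refine norm_cesaroMeans_le_of_sum 𝕜 ?_
  refine (Finset.sum_le_card_nsmul _ _ r fun i hi => h i ?_).trans ?_
  · simpa [Nat.lt_succ_iff] using hi
  · simp

lemma norm_cesaroMeans_sub_le {x : ℕ → X} {a : X} {k : ℕ} {r : ℝ} (h : ∀ i ≤ k, ‖x i - a‖ ≤ r) :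
    ‖cesaroMeans 𝕜 x k - a‖ ≤ r := by
  have := norm_cesaroMeans_le 𝕜 (x := fun i => x i - a) h
  rwa [cesaroMeans_sub, cesaroMeans_const] at this

variable {𝕜} in
lemma map_cesaroMeans {Y : Type*} [NormedAddCommGroup Y] [NormedSpace 𝕜 Y] (g : X →L[𝕜] Y)
    (x : ℕ → X) (k : ℕ) : g (cesaroMeans 𝕜 x k) = cesaroMeans 𝕜 (fun i => g (x i)) k := by
  simp [cesaroMeans, map_sum]

lemma tendsto_cesaroMeans {x : ℕ → X} {a : X} (h : Tendsto x atTop (𝓝 a)) :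
    Tendsto (cesaroMeans 𝕜 x) atTop (𝓝 a) := by
  let _ : NormedSpace ℝ X := NormedSpace.restrictScalars ℝ 𝕜 X
  have := (h.cesaro_smul).comp (tendsto_add_atTop_nat 1)
  refine this.congr fun k => ?_
  simp only [Function.comp, cesaroMeans]
  change (((((k + 1 : ℕ) : ℝ)⁻¹ : ℝ) : 𝕜) • _ : X) = _
  simp

lemma cca_le_of_norm_sub_le {x : ℕ → X} {a : X} {r : ℝ} (h : ∀ i, ‖x i - a‖ ≤ r) :
    cca 𝕜 x ≤ ENNReal.ofReal (2 * r) := by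
  refine ca_le_ofReal ⟨0, fun k _ l _ => ?_⟩
  have h1 := norm_cesaroMeans_sub_le 𝕜 (k := k) fun i _ => h i
  have h2 := norm_cesaroMeans_sub_le 𝕜 (k := l) fun i _ => h i
  rw [← sub_sub_sub_cancel_right _ _ a]
  exact (norm_sub_le _ _).trans (by linarith)

lemma ccaTilde_le_cca (x : ℕ → X) {φ : ℕ → ℕ} (hφ : StrictMono φ) :
    ccaTilde 𝕜 x ≤ cca 𝕜 (x ∘ φ) := iInf₂_le φ hφ

lemma ccaTilde_le_comp (x : ℕ → X) {φ : ℕ → ℕ} (hφ : StrictMono φ) :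
    ccaTilde 𝕜 x ≤ ccaTilde 𝕜 (x ∘ φ) :=
  le_iInf₂ fun ψ hψ => iInf₂_le (φ ∘ ψ) (hφ.comp hψ)

lemma ccaTilde_sub_const (x : ℕ → X) (a : X) :
    ccaTilde 𝕜 (fun k => x k - a) = ccaTilde 𝕜 x := by
  refine iInf_congr fun φ => iInf_congr fun _ => ?_
  have : cesaroMeans 𝕜 ((fun k => x k - a) ∘ φ) = fun k => cesaroMeans 𝕜 (x ∘ φ) k - a := by
    ext k
    rw [← cesaroMeans_const 𝕜 a k, ← cesaroMeans_sub, cesaroMeans_const]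
    rfl
  rw [cca, this, ca_sub_const, cca]

lemma bs_closedBall_le_two : bs 𝕜 (Metric.closedBall (0 : X) 1) ≤ 2 := by
  refine iSup₂_le fun x hx => (ccaTilde_le_cca 𝕜 x strictMono_id).trans ?_
  refine (cca_le_of_norm_sub_le 𝕜 (a := 0) (r := 1) fun i => ?_).trans (by simp)
  simpa using hx i

lemma ofReal_le_bs {A : Set X} {c : ℝ}
    (h : ∀ r < c, ∃ x : ℕ → X, (∀ k, x k ∈ A) ∧ ENNReal.ofReal r ≤ ccaTilde 𝕜 x) :
    ENNReal.ofReal c ≤ bs 𝕜 A := by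
  refine ofReal_le_of_forall_lt fun r hr => ?_
  obtain ⟨x, hx, hr⟩ := h r hr
  exact hr.trans (le_iSup₂ (f := fun x (_ : ∀ k, x k ∈ A) => ccaTilde 𝕜 x) x hx)

lemma wbs_eq_zero {A : Set X}
    (h : ∀ x : ℕ → X, (∀ k, x k ∈ A) → ∀ a, (∀ f : StrongDual 𝕜 X,
      Tendsto (fun k => f (x k)) atTop (𝓝 (f a))) →
      ∀ ε > 0, ccaTilde 𝕜 x ≤ ENNReal.ofReal ε) : wbs 𝕜 A = 0 := by
  refine le_antisymm (iSup₂_le fun x hx => iSup_le fun ⟨a, ha⟩ => ?_) bot_le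
  rw [← ENNReal.ofReal_zero]
  refine le_ofReal_of_forall_pos fun ε hε => ?_
  rw [zero_add]
  refine h x hx a (fun f => ?_) ε hε
  exact ((WeakBilin.eval_continuous (topDualPairing 𝕜 X).flip f).tendsto _).comp ha

variable {𝕜} in
/-- A sequence that every tail can be separated from its initial segment by a functional taking
approximately the value `α` on the initial segment and `β` on the tail. -/
lemma le_ccaTilde_of_functionals {x : ℕ → X} {α β : 𝕜} {ε : ℝ}
    (h : ∀ m, ∃ g : X →L[𝕜] 𝕜, (∀ v, ‖g v‖ ≤ ‖v‖) ∧ (∀ k < m, ‖g (x k) - α‖ ≤ ε) ∧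
      ∀ k, m ≤ k → ‖g (x k) - β‖ ≤ ε) :
    ENNReal.ofReal (‖β - α‖ - 2 * ε) ≤ ccaTilde 𝕜 x := by
  refine le_iInf₂ fun φ hφ => ofReal_le_ca fun n s hs => ?_
  -- Cutting just after `φ n` makes the mean of index `n` see only values near `α`; `w` is the
  -- idealised step sequence, whose means tend to `β`.
  obtain ⟨g, hg, hα, hβ⟩ := h (φ n + 1)
  set w : ℕ → 𝕜 := fun i => if i ≤ n then α else β with hw
  have hz : ∀ i, ‖g (x (φ i)) - w i‖ ≤ ε := fun i => by
    by_cases hi : i ≤ n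
    · simpa [hw, hi] using hα (φ i) (Nat.lt_succ_of_le (hφ.monotone hi))
    · simpa [hw, hi] using hβ (φ i) (hφ (not_le.1 hi))
  have hwβ : Tendsto w atTop (𝓝 β) := by
    refine tendsto_const_nhds.congr' ?_
    filter_upwards [eventually_gt_atTop n] with i hi
    simp [hw, hi]
  have hlim : Tendsto (fun l => ‖cesaroMeans 𝕜 w l - α‖ - 2 * ε) atTop (𝓝 (‖β - α‖ - 2 * ε)) :=
    (((tendsto_cesaroMeans 𝕜 hwβ).sub_const α).norm).sub_const _
  obtain ⟨l, hl, hnl⟩ := ((hlim.eventually (lt_mem_nhds hs)).and (eventually_ge_atTop n)).exists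
  refine ⟨n, le_rfl, l, hnl, ?_⟩
  have h1 : ‖cesaroMeans 𝕜 (fun i => g (x (φ i))) n - α‖ ≤ ε :=
    norm_cesaroMeans_sub_le 𝕜 fun i hi => by simpa [hw, hi] using hz i
  have h2 : ‖cesaroMeans 𝕜 (fun i => g (x (φ i))) l - cesaroMeans 𝕜 w l‖ ≤ ε := by
    rw [← cesaroMeans_sub]
    exact norm_cesaroMeans_le 𝕜 fun i _ => hz i
  have h3 := hg (cesaroMeans 𝕜 (x ∘ φ) n - cesaroMeans 𝕜 (x ∘ φ) l)
  rw [map_sub, map_cesaroMeans, map_cesaroMeans] at h3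
  simp only [Function.comp] at h3
  have h4 := norm_add₃_le
    (a := cesaroMeans 𝕜 w l - cesaroMeans 𝕜 (fun i => g (x (φ i))) l)
    (b := cesaroMeans 𝕜 (fun i => g (x (φ i))) l - cesaroMeans 𝕜 (fun i => g (x (φ i))) n)
    (c := cesaroMeans 𝕜 (fun i => g (x (φ i))) n - α)
  rw [sub_add_sub_cancel, sub_add_sub_cancel, norm_sub_rev (cesaroMeans 𝕜 w l) (cesaroMeans 𝕜 _ l),
    norm_sub_rev (cesaroMeans 𝕜 (fun i => g (x (φ i))) l) (cesaroMeans 𝕜 _ n)] at h4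
  change s ≤ ‖cesaroMeans 𝕜 (x ∘ φ) n - cesaroMeans 𝕜 (x ∘ φ) l‖
  linarith

end Basic

/-! ### Gliding humps and perturbed step sequences. -/

section GlidingHump

/-- The gliding hump argument: `H N k` says that the part of the `k`-th term before `N` is under
control, `T N k` that the part from `N` on is. -/
lemma exists_gliding_hump {H T : ℕ → ℕ → Prop} (hH : ∀ N, ∀ᶠ k in atTop, H N k)
    (hT : ∀ k, ∀ᶠ N in atTop, T N k) :
    ∃ φ N : ℕ → ℕ, StrictMono φ ∧ StrictMono N ∧ N 0 = 0 ∧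
      ∀ j, H (N j) (φ j) ∧ T (N (j + 1)) (φ j) := by
  have hH' : ∀ N k₀, ∃ k, k₀ < k ∧ H N k := fun N k₀ =>
    ((eventually_gt_atTop k₀).and (hH N)).exists
  have hT' : ∀ k N₀, ∃ N, N₀ < N ∧ T N k := fun k N₀ =>
    ((eventually_gt_atTop N₀).and (hT k)).exists
  choose K hKlt hK using hH'
  choose M hMlt hM using hT'
  -- The state is `(N j, φ j)`: the next cut is chosen for the current term, then the next term for
  -- that cut.
  let s : ℕ → ℕ × ℕ := fun j => Nat.rec (0, K 0 0)
    (fun _ p => (M p.2 p.1, K (M p.2 p.1) p.2)) j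
  refine ⟨fun j => (s j).2, fun j => (s j).1, strictMono_nat_of_lt_succ fun j => hKlt _ _,
    strictMono_nat_of_lt_succ fun j => hMlt _ _, rfl, fun j => ⟨?_, hM _ _⟩⟩
  cases j with
  | zero => exact hK _ _
  | succ j => exact hK _ _

variable {𝕜 : Type*} [RCLike 𝕜]

/-- A subsequence each of whose coordinates is approximately a step sequence from `0` to the
limit, except for one term. -/
lemma exists_subseq_one_hump {u : ℕ → ℕ → 𝕜} {x : ℕ → 𝕜} {ε : ℝ} (hε : 0 < ε)
    (hx : ∀ n, Tendsto (fun k => u k n) atTop (𝓝 (x n)))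
    (hu : ∀ k, ∀ᶠ n in atTop, ‖u k n‖ ≤ ε) :
    ∃ φ : ℕ → ℕ, StrictMono φ ∧ ∀ n, ∃ j, (∀ i < j, ‖u (φ i) n‖ ≤ ε) ∧
      ∀ i, j < i → ‖u (φ i) n - x n‖ ≤ ε := by
  obtain ⟨φ, N, hφ, hN, hN0, hj⟩ := exists_gliding_hump
    (H := fun N k => ∀ n < N, ‖u k n - x n‖ ≤ ε) (T := fun N k => ∀ n, N ≤ n → ‖u k n‖ ≤ ε)
    (fun N => by
      have : ∀ n ∈ Set.Iio N, ∀ᶠ k in atTop, ‖u k n - x n‖ ≤ ε := fun n _ => by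
        have := ((hx n).sub_const (x n)).norm
        rw [sub_self, norm_zero] at this
        exact this.eventually (ge_mem_nhds hε)
      exact ((Set.finite_Iio N).eventually_all).2 this)
    (fun k => by
      obtain ⟨N, hN⟩ := eventually_atTop.1 (hu k)
      exact eventually_atTop.2 ⟨N, fun M hM n hn => hN n (hM.trans hn)⟩)
  refine ⟨φ, hφ, fun n => ?_⟩
  -- The exceptional term is the `j` whose block `[N j, N (j + 1))` contains `n`: for earlier terms
  -- `n` lies in the tail, for later ones in the head.
  have hex : ∃ j, n < N (j + 1) := ⟨n, (Nat.lt_succ_self n).trans_le (hN.le_apply)⟩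
  refine ⟨Nat.find hex, fun i hi => (hj i).2 n (not_lt.1 (Nat.find_min hex hi)), fun i hi => ?_⟩
  exact (hj i).1 n ((Nat.find_spec hex).trans_le (hN.monotone hi))

/-- Here `t` is the proportion of indices beyond `j`. Having all means on one segment gives distance
`‖b‖` rather than `2‖b‖`, hence the value 1 for `c₀`. -/
lemma exists_cesaroMeans_step (b : 𝕜) (j k : ℕ) : ∃ t : ℝ, 0 ≤ t ∧ t ≤ 1 ∧
    cesaroMeans 𝕜 (fun i => if i ≤ j then 0 else b) k = (t : 𝕜) * b := by
  have hk : (0 : ℝ) < (k : ℝ) + 1 := by positivity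
  refine ⟨((k : ℝ) + 1)⁻¹ * ((Finset.range (k + 1)).filter (fun i => ¬ i ≤ j)).card,
    by positivity, ?_, ?_⟩
  · rw [inv_mul_le_iff₀ hk, mul_one]
    have := Finset.card_filter_le (Finset.range (k + 1)) (fun i => ¬ i ≤ j)
    rw [Finset.card_range] at this
    exact_mod_cast this
  · rw [cesaroMeans, Finset.sum_ite, Finset.sum_const_zero, zero_add, Finset.sum_const]
    simp [mul_assoc]

/-- The single uncontrolled term is diluted by averaging. The bound does not involve its position
`j`, so it is uniform over coordinates. -/
lemma norm_cesaroMeans_sub_le_of_one_hump {z : ℕ → 𝕜} {b : 𝕜} {C ε : ℝ} {j n k l : ℕ}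
    (hε : 0 ≤ ε) (hC : ∀ i, ‖z i‖ ≤ C) (h0 : ∀ i < j, ‖z i‖ ≤ ε)
    (hb : ∀ i, j < i → ‖z i - b‖ ≤ ε) (hk : n ≤ k) (hl : n ≤ l) :
    ‖cesaroMeans 𝕜 z k - cesaroMeans 𝕜 z l‖ ≤ ‖b‖ + 2 * ε + 2 * (C / ((n : ℝ) + 1)) := by
  set w : ℕ → 𝕜 := fun i => if i ≤ j then 0 else b with hw
  have hC0 : 0 ≤ C := (norm_nonneg _).trans (hC 0)
  have key : ∀ m, n ≤ m →
      ‖cesaroMeans 𝕜 z m - cesaroMeans 𝕜 w m‖ ≤ ε + C / ((n : ℝ) + 1) := fun m hm => by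
    rw [← cesaroMeans_sub]
    refine norm_cesaroMeans_le_of_sum 𝕜 ?_
    have hi : ∀ i, ‖z i - w i‖ ≤ ε + if i = j then C else 0 := fun i => by
      rcases lt_trichotomy i j with h | h | h
      · simpa [hw, h.le, h.ne] using h0 i h
      · subst h
        simpa [hw] using (hC i).trans (le_add_of_nonneg_left hε)
      · simpa [hw, h.not_ge, h.ne'] using hb i h
    have hnm : ((n : ℝ) + 1) ≤ (m : ℝ) + 1 := by exact_mod_cast Nat.succ_le_succ hm
    have hCn : C ≤ ((m : ℝ) + 1) * (C / ((n : ℝ) + 1)) := by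
      rw [mul_div_assoc', le_div_iff₀ (by positivity), mul_comm]
      exact mul_le_mul_of_nonneg_right hnm hC0
    calc ∑ i ∈ Finset.range (m + 1), ‖z i - w i‖
        ≤ ∑ i ∈ Finset.range (m + 1), (ε + if i = j then C else 0) :=
          Finset.sum_le_sum fun i _ => hi i
      _ ≤ ((m : ℝ) + 1) * ε + C := by
          rw [Finset.sum_add_distrib, Finset.sum_ite_eq', Finset.sum_const, Finset.card_range,
            nsmul_eq_mul, Nat.cast_succ]
          gcongr
          split_ifs
          · exact le_rfl
          · exact hC0
      _ ≤ _ := by rw [mul_add]; gcongr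
  obtain ⟨s, hs0, hs1, hs⟩ := exists_cesaroMeans_step b j k
  obtain ⟨t, ht0, ht1, ht⟩ := exists_cesaroMeans_step b j l
  have hst : ‖cesaroMeans 𝕜 w k - cesaroMeans 𝕜 w l‖ ≤ ‖b‖ := by
    rw [hs, ht, ← sub_mul, norm_mul, ← RCLike.ofReal_sub, RCLike.norm_ofReal]
    exact mul_le_of_le_one_left (norm_nonneg _) (abs_le.2 ⟨by linarith, by linarith⟩)
  have h4 := norm_add₃_le
    (a := cesaroMeans 𝕜 z k - cesaroMeans 𝕜 w k)
    (b := cesaroMeans 𝕜 w k - cesaroMeans 𝕜 w l)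
    (c := cesaroMeans 𝕜 w l - cesaroMeans 𝕜 z l)
  rw [sub_add_sub_cancel, sub_add_sub_cancel, norm_sub_rev (cesaroMeans 𝕜 w l)] at h4
  linarith [key k hk, key l hl]

variable {E : Type*} [NormedAddCommGroup E] [NormedSpace 𝕜 E]

/-- `E` is normed by the coordinate functionals `e n`, as `c₀` and `c` are. -/
lemma ccaTilde_le_of_coordinates {e : ℕ → E →L[𝕜] 𝕜}
    (he : ∀ v r, 0 ≤ r → (∀ n, ‖e n v‖ ≤ r) → ‖v‖ ≤ r)
    {x : ℕ → E} {a : ℕ → 𝕜} {B C ε : ℝ} (hε : 0 < ε) (hB : 0 ≤ B)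
    (hC : ∀ k n, ‖e n (x k)‖ ≤ C) (ha : ∀ n, Tendsto (fun k => e n (x k)) atTop (𝓝 (a n)))
    (haB : ∀ n, ‖a n‖ ≤ B) (hx : ∀ k, ∀ᶠ n in atTop, ‖e n (x k)‖ ≤ ε) :
    ccaTilde 𝕜 x ≤ ENNReal.ofReal (B + 4 * ε) := by
  obtain ⟨φ, hφ, h⟩ := exists_subseq_one_hump hε ha hx
  refine (ccaTilde_le_cca 𝕜 x hφ).trans (ca_le_ofReal ?_)
  have hlim : Tendsto (fun n : ℕ => C / ((n : ℝ) + 1)) atTop (𝓝 0) :=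
    (tendsto_const_nhds.div_atTop
      (tendsto_atTop_add_const_right _ 1 tendsto_natCast_atTop_atTop))
  obtain ⟨m, hm⟩ := (hlim.eventually (ge_mem_nhds hε)).exists
  refine ⟨m, fun k hk l hl => he _ _ (by positivity) fun n => ?_⟩
  obtain ⟨j, h0, hb⟩ := h n
  rw [map_sub, map_cesaroMeans, map_cesaroMeans]
  refine (norm_cesaroMeans_sub_le_of_one_hump hε.le (fun i => hC (φ i) n) h0 hb hk hl).trans ?_
  linarith [haB n]

end GlidingHump

/-! ### The spaces `c₀` and `c`. -/

section SequenceSpaces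

variable (𝕜 : Type*) [RCLike 𝕜]

/-- The coordinate functionals on `c₀`. -/
noncomputable def coordCZero (n : ℕ) : SeqCZero 𝕜 →L[𝕜] 𝕜 :=
  LinearMap.mkContinuous ⟨⟨fun v => v n, fun _ _ => rfl⟩, fun _ _ => rfl⟩ 1 fun v => by
    rw [one_mul, ← ZeroAtInftyContinuousMap.norm_toBCF_eq_norm]
    exact v.toBCF.norm_coe_le_norm n

/-- The coordinate functionals on `c`. -/
noncomputable def coordC (n : ℕ) : seqC 𝕜 →L[𝕜] 𝕜 :=
  LinearMap.mkContinuous ⟨⟨fun v => v.1 n, fun _ _ => rfl⟩, fun _ _ => rfl⟩ 1 fun v => by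
    rw [one_mul]
    exact v.1.norm_coe_le_norm n

variable {𝕜}

lemma norm_coordCZero_le (n : ℕ) (v : SeqCZero 𝕜) : ‖coordCZero 𝕜 n v‖ ≤ ‖v‖ := by
  rw [← ZeroAtInftyContinuousMap.norm_toBCF_eq_norm]
  exact v.toBCF.norm_coe_le_norm n

lemma norm_coordC_le (n : ℕ) (v : seqC 𝕜) : ‖coordC 𝕜 n v‖ ≤ ‖v‖ := v.1.norm_coe_le_norm n

lemma norm_le_of_coordCZero (v : SeqCZero 𝕜) (r : ℝ) (hr : 0 ≤ r)
    (h : ∀ n, ‖coordCZero 𝕜 n v‖ ≤ r) : ‖v‖ ≤ r := by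
  rw [← ZeroAtInftyContinuousMap.norm_toBCF_eq_norm]
  exact (BoundedContinuousFunction.norm_le hr).2 h

lemma norm_le_of_coordC (v : seqC 𝕜) (r : ℝ) (hr : 0 ≤ r)
    (h : ∀ n, ‖coordC 𝕜 n v‖ ≤ r) : ‖v‖ ≤ r :=
  (BoundedContinuousFunction.norm_le (f := v.1) hr).2 h

lemma tendsto_coordCZero (v : SeqCZero 𝕜) :
    Tendsto (fun n => coordCZero 𝕜 n v) atTop (𝓝 0) := by
  have := v.zero_at_infty'
  rwa [cocompact_eq_cofinite, Nat.cofinite_eq_atTop] at this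

lemma eventually_norm_coordCZero_le (v : SeqCZero 𝕜) {ε : ℝ} (hε : 0 < ε) :
    ∀ᶠ n in atTop, ‖coordCZero 𝕜 n v‖ ≤ ε := by
  have := (tendsto_coordCZero v).norm
  rw [norm_zero] at this
  exact this.eventually (ge_mem_nhds hε)

lemma wbs_closedBall_seqCZero : wbs 𝕜 (Metric.closedBall (0 : SeqCZero 𝕜) 1) = 0 := by
  refine wbs_eq_zero 𝕜 fun x hx a ha ε hε => ?_
  rw [← ccaTilde_sub_const 𝕜 x a]
  have hC : ∀ k n, ‖coordCZero 𝕜 n (x k - a)‖ ≤ 1 + ‖a‖ := fun k n => by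
    refine (norm_coordCZero_le n _).trans ((norm_sub_le _ _).trans ?_)
    gcongr
    exact mem_closedBall_zero_iff.1 (hx k)
  have hlim : ∀ n, Tendsto (fun k => coordCZero 𝕜 n (x k - a)) atTop (𝓝 0) := fun n => by
    have := (ha (coordCZero 𝕜 n)).sub_const (coordCZero 𝕜 n a)
    rw [sub_self] at this
    exact this.congr fun k => (map_sub _ _ _).symm
  have := ccaTilde_le_of_coordinates norm_le_of_coordCZero (a := 0) (B := 0) (by positivity)
    le_rfl hC hlim (by simp)
    fun k => eventually_norm_coordCZero_le (x k - a) (ε := ε / 4) (by positivity)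
  rwa [zero_add, mul_div_cancel₀ _ four_ne_zero] at this

/-- Tychonoff gives a coordinatewise convergent subsequence. Its limit need not be a null sequence;
only the bound 1 on its entries matters. -/
lemma bs_closedBall_seqCZero_le : bs 𝕜 (Metric.closedBall (0 : SeqCZero 𝕜) 1) ≤ 1 := by
  refine iSup₂_le fun x hx => ?_
  have hx1 : ∀ k n, ‖coordCZero 𝕜 n (x k)‖ ≤ 1 := fun k n =>
    (norm_coordCZero_le n _).trans (mem_closedBall_zero_iff.1 (hx k))
  obtain ⟨a, ha, φ, hφ, hlim⟩ := (isCompact_univ_pi fun _ : ℕ =>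
    isCompact_closedBall (0 : 𝕜) 1).tendsto_subseq (x := fun k n => coordCZero 𝕜 n (x k))
      (fun k n _ => mem_closedBall_zero_iff.2 (hx1 k n))
  have ha1 : ∀ n, ‖a n‖ ≤ 1 := fun n => mem_closedBall_zero_iff.1 (ha n trivial)
  rw [← ENNReal.ofReal_one]
  refine le_ofReal_of_forall_pos fun ε hε => (ccaTilde_le_comp 𝕜 x hφ).trans ?_
  have := ccaTilde_le_of_coordinates norm_le_of_coordCZero (x := x ∘ φ) (by positivity)
    zero_le_one (fun k n => hx1 _ n) (tendsto_pi_nhds.1 hlim) ha1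
    fun k => eventually_norm_coordCZero_le (x (φ k)) (ε := ε / 4) (by positivity)
  rwa [mul_div_cancel₀ _ four_ne_zero] at this

/-- The limit functional on `c`. -/
lemma exists_lim_functional : ∃ L : seqC 𝕜 →L[𝕜] 𝕜, ∀ v : seqC 𝕜,
    Tendsto (fun n => coordC 𝕜 n v) atTop (𝓝 (L v)) := by
  choose L hL using fun v : seqC 𝕜 => v.2
  refine ⟨LinearMap.mkContinuous ⟨⟨L, fun v w => ?_⟩, fun c v => ?_⟩ 1 fun v => ?_, hL⟩
  · exact tendsto_nhds_unique (hL (v + w)) ((hL v).add (hL w))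
  · exact tendsto_nhds_unique (hL (c • v)) ((hL v).const_smul c)
  · rw [one_mul]
    exact le_of_tendsto (hL v).norm (Eventually.of_forall fun n => norm_coordC_le n v)

/-- Elements of `c` need not have small tails, but the limit functional is weakly continuous: after
subtracting the weak limit and dropping finitely many terms, all limits are below `ε / 4`. -/
lemma wbs_closedBall_seqC : wbs 𝕜 (Metric.closedBall (0 : seqC 𝕜) 1) = 0 := by
  refine wbs_eq_zero 𝕜 fun x hx a ha ε hε => ?_
  obtain ⟨L, hL⟩ := exists_lim_functional (𝕜 := 𝕜)
  have hLx : Tendsto (fun k => ‖L (x k - a)‖) atTop (𝓝 0) := by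
    have := ((ha L).sub_const (L a)).norm
    rw [sub_self, norm_zero] at this
    exact this.congr fun k => by rw [map_sub]
  obtain ⟨m, hm⟩ := eventually_atTop.1 (hLx.eventually (gt_mem_nhds (by positivity : 0 < ε / 4)))
  have hsh : StrictMono fun k => k + m := fun i j hij => Nat.add_lt_add_right hij m
  rw [← ccaTilde_sub_const 𝕜 x a]
  refine (ccaTilde_le_comp 𝕜 _ hsh).trans ?_
  have hC : ∀ k n, ‖coordC 𝕜 n (x (k + m) - a)‖ ≤ 1 + ‖a‖ := fun k n => by
    refine (norm_coordC_le n _).trans ((norm_sub_le _ _).trans ?_)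
    gcongr
    exact mem_closedBall_zero_iff.1 (hx (k + m))
  have hlim : ∀ n, Tendsto (fun k => coordC 𝕜 n (x (k + m) - a)) atTop (𝓝 0) := fun n => by
    have := ((ha (coordC 𝕜 n)).sub_const (coordC 𝕜 n a)).comp (tendsto_add_atTop_nat m)
    rw [sub_self] at this
    exact this.congr fun k => (map_sub _ _ _).symm
  have htail : ∀ k, ∀ᶠ n in atTop, ‖coordC 𝕜 n (x (k + m) - a)‖ ≤ ε / 4 := fun k =>
    ((hL (x (k + m) - a)).norm.eventually
      (gt_mem_nhds (hm (k + m) (Nat.le_add_left m k)))).mono fun n hn => hn.le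
  have := ccaTilde_le_of_coordinates (E := seqC 𝕜) (e := coordC 𝕜)
    (x := (fun k => x k - a) ∘ fun k => k + m) norm_le_of_coordC (a := 0) (B := 0) (by positivity) le_rfl hC hlim (by simp) htail
  rwa [zero_add, mul_div_cancel₀ _ four_ne_zero] at this

lemma exists_seqCZero_of_eventually_eq_zero (f : ℕ → 𝕜) (hf : ∀ᶠ n in atTop, f n = 0) :
    ∃ v : SeqCZero 𝕜, ∀ n, coordCZero 𝕜 n v = f n := by
  refine ⟨⟨⟨f, continuous_of_discreteTopology⟩, ?_⟩, fun n => rfl⟩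
  rw [cocompact_eq_cofinite, Nat.cofinite_eq_atTop]
  exact tendsto_const_nhds.congr' (hf.mono fun n hn => hn.symm)

/-- The witness is the summing basis; its `m`-th coordinate jumps from 0 to 1 at the term of index
`m`. -/
lemma one_le_bs_closedBall_seqCZero : 1 ≤ bs 𝕜 (Metric.closedBall (0 : SeqCZero 𝕜) 1) := by
  choose x hx using fun k : ℕ => exists_seqCZero_of_eventually_eq_zero
    (fun n => if n ≤ k then (1 : 𝕜) else 0)
    ((eventually_gt_atTop k).mono fun n hn => by simp [hn])
  rw [← ENNReal.ofReal_one]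
  refine ofReal_le_bs 𝕜 fun r hr => ⟨x, fun k => ?_, ?_⟩
  · rw [mem_closedBall_zero_iff]
    refine norm_le_of_coordCZero _ _ zero_le_one fun n => ?_
    rw [hx]
    split_ifs <;> simp
  · refine (ENNReal.ofReal_le_ofReal ?_).trans (le_ccaTilde_of_functionals (α := (0 : 𝕜))
      (β := 1) (ε := 0) fun m => ⟨coordCZero 𝕜 m, norm_coordCZero_le m, ?_, ?_⟩)
    · simpa using hr.le
    · intro k hk
      rw [hx, if_neg hk.not_ge]; simp
    · intro k hk
      rw [hx, if_pos hk]; simp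

lemma exists_seqC_of_tendsto {f : ℕ → 𝕜} {a : 𝕜} (hf : Tendsto f atTop (𝓝 a)) :
    ∃ v : seqC 𝕜, ∀ n, coordC 𝕜 n v = f n := by
  obtain ⟨C, hC⟩ := (Metric.isBounded_range_of_tendsto f hf).exists_norm_le
  exact ⟨⟨BoundedContinuousFunction.ofNormedAddCommGroup f continuous_of_discreteTopology C
    fun n => hC _ ⟨n, rfl⟩, a, hf⟩, fun n => rfl⟩

/-- In `c` the zero tail of the summing basis may be replaced by -1, which doubles the jump. -/
lemma bs_closedBall_seqC : bs 𝕜 (Metric.closedBall (0 : seqC 𝕜) 1) = 2 := by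
  refine le_antisymm (bs_closedBall_le_two 𝕜) ?_
  choose x hx using fun k : ℕ => exists_seqC_of_tendsto
    (f := fun n => if n ≤ k then (1 : 𝕜) else -1) (a := -1)
    (tendsto_const_nhds.congr' ((eventually_gt_atTop k).mono fun n hn => by simp [hn]))
  have : ENNReal.ofReal 2 ≤ bs 𝕜 (Metric.closedBall (0 : seqC 𝕜) 1) := by
    refine ofReal_le_bs 𝕜 fun r hr => ⟨x, fun k => ?_, ?_⟩
    · rw [mem_closedBall_zero_iff]
      refine norm_le_of_coordC _ _ zero_le_one fun n => ?_
      rw [hx]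
      split_ifs <;> simp
    · refine (ENNReal.ofReal_le_ofReal ?_).trans (le_ccaTilde_of_functionals (α := (-1 : 𝕜))
        (β := 1) (ε := 0) fun m => ⟨coordC 𝕜 m, norm_coordC_le m, ?_, ?_⟩)
      · rw [sub_neg_eq_add, one_add_one_eq_two, RCLike.norm_ofNat]
        linarith
      · intro k hk
        rw [hx, if_neg hk.not_ge]; simp
      · intro k hk
        rw [hx, if_pos hk]; simp
  simpa using this

end SequenceSpaces

/-! ### Copies of `ℓ₁`, and the Schur property. -/

section EllOne

variable {𝕜 : Type*} [RCLike 𝕜]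

lemma EllOne.hasSum_norm (v : EllOne 𝕜) : HasSum (fun n => ‖v n‖) ‖v‖ := by
  have := lp.hasSum_norm (p := 1) (by simp) v
  simpa using this

lemma EllOne.norm_add_of_disjoint {v w : EllOne 𝕜} (h : ∀ n, v n = 0 ∨ w n = 0) :
    ‖v + w‖ = ‖v‖ + ‖w‖ := by
  refine (EllOne.hasSum_norm (v + w)).unique ?_
  refine ((EllOne.hasSum_norm v).add (EllOne.hasSum_norm w)).congr_fun fun n => ?_
  rw [lp.coeFn_add, Pi.add_apply]
  rcases h n with h | h <;> simp [h]

lemma EllOne.norm_sum_of_disjoint {u : ℕ → EllOne 𝕜}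
    (h : ∀ i j n, i ≠ j → u i n = 0 ∨ u j n = 0) (s : Finset ℕ) :
    ‖∑ i ∈ s, u i‖ = ∑ i ∈ s, ‖u i‖ := by
  classical
  induction s using Finset.induction_on with
  | empty => simp
  | insert j s hj ih =>
    rw [Finset.sum_insert hj, Finset.sum_insert hj, EllOne.norm_add_of_disjoint, ih]
    intro n
    by_cases hjn : u j n = 0
    · exact Or.inl hjn
    · right
      rw [lp.coeFn_sum, Finset.sum_apply]
      exact Finset.sum_eq_zero fun i hi =>
        (h i j n (fun hij => hj (hij ▸ hi))).resolve_right hjn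

variable {X : Type*} [NormedAddCommGroup X] [NormedSpace 𝕜 X]

/-- A sequence with a lower `ℓ₁`-estimate with constant `q`, valid for all its subsequences. -/
def HasLowerEllOneEstimate (𝕜 : Type*) {X : Type*} [RCLike 𝕜] [NormedAddCommGroup X]
    [NormedSpace 𝕜 X] (q : ℝ) (y : ℕ → X) : Prop :=
  ∀ φ : ℕ → ℕ, StrictMono φ → ∀ (n : ℕ) (a : ℕ → 𝕜),
    q * ∑ i ∈ Finset.range n, ‖a i‖ ≤ ‖∑ i ∈ Finset.range n, a i • y (φ i)‖

/-- James's distortion theorem for `ℓ₁`. -/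
lemma exists_hasLowerEllOneEstimate (T : EllOne 𝕜 →L[𝕜] X) {c : ℝ} (hc : 0 < c)
    (hT : ∀ v, c * ‖v‖ ≤ ‖T v‖) {δ : ℝ} (hδ : 0 < δ) :
    ∃ y : ℕ → X, (∀ k, ‖y k‖ ≤ 1) ∧ HasLowerEllOneEstimate 𝕜 (1 - δ) y := by
  set S : ℕ → EllOne 𝕜 → Prop := fun m v => (∀ i < m, v i = 0) ∧ ∃ N, ∀ i, N ≤ i → v i = 0
    with hS
  -- The supremum `L` is the asymptotic lower bound of `T`: a `t` just below `L` works from some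
  -- `m₀` on, while `R` just above `L` fails on every tail, which yields unit blocks with `‖T v‖ ≤
  -- R`. Dividing by `R` leaves the constant `t / R ≥ 1 - δ`.
  set A : Set ℝ := {t | ∃ m, ∀ v, S m v → t * ‖v‖ ≤ ‖T v‖} with hA
  have hsingle : ∀ m, S m (lp.single 1 m 1) := fun m => ⟨fun i hi => by
    rw [lp.single_apply, Pi.single_apply, if_neg hi.ne], m + 1, fun i hi => by
    rw [lp.single_apply, Pi.single_apply, if_neg (Nat.lt_of_succ_le hi).ne']⟩
  have hcA : c ∈ A := ⟨0, fun v _ => hT v⟩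
  have hbdd : BddAbove A := by
    refine ⟨‖T‖, fun t ⟨m, ht⟩ => ?_⟩
    have h1 := ht _ (hsingle m)
    have h2 := T.le_opNorm (lp.single 1 m 1)
    rw [lp.norm_single (by simp), norm_one, mul_one] at h1 h2
    exact h1.trans h2
  set L := sSup A with hL
  have hL0 : 0 < L := hc.trans_le (le_csSup hbdd hcA)
  obtain ⟨t, ⟨m₀, ht⟩, hLt⟩ := exists_lt_of_lt_csSup ⟨c, hcA⟩
    (show L * (1 - δ / 2) < sSup A by rw [← hL]; nlinarith)
  set R := L * (1 + δ / 2) with hR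
  have hR0 : 0 < R := by positivity
  have hblock : ∀ m, ∃ v, S m v ∧ ‖v‖ = 1 ∧ ‖T v‖ ≤ R := fun m => by
    have hRA : R ∉ A := fun h => by
      have := le_csSup hbdd h
      rw [← hL] at this
      nlinarith
    have : ∃ v, S m v ∧ ‖T v‖ < R * ‖v‖ := by
      by_contra! hall
      exact hRA ⟨m, hall⟩
    obtain ⟨v, ⟨hv0, N, hvN⟩, hv⟩ := this
    have hvpos : 0 < ‖v‖ := pos_of_mul_pos_right ((norm_nonneg _).trans_lt hv) hR0.le
    refine ⟨(‖v‖ : 𝕜)⁻¹ • v, ⟨fun i hi => ?_, N, fun i hi => ?_⟩, ?_, ?_⟩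
    · rw [lp.coeFn_smul, Pi.smul_apply, hv0 i hi, smul_zero]
    · rw [lp.coeFn_smul, Pi.smul_apply, hvN i hi, smul_zero]
    · rw [norm_smul, norm_inv, RCLike.norm_ofReal, abs_of_pos hvpos, inv_mul_cancel₀ hvpos.ne']
    · rw [map_smul, norm_smul, norm_inv, RCLike.norm_ofReal, abs_of_pos hvpos,
        inv_mul_le_iff₀ hvpos, mul_comm]
      exact hv.le
  choose v hvS hv1 hvR using hblock
  choose B hB using fun m => (hvS m).2
  -- Each block starts past the support of the previous one, and the first at `m₀`, so the estimate
  -- for `t` applies to all combinations.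
  let N : ℕ → ℕ := fun j => Nat.rec m₀ (fun _ m => max (m + 1) (B m)) j
  have hNsucc : ∀ j, N (j + 1) = max (N j + 1) (B (N j)) := fun j => rfl
  have hNmono : StrictMono N := strictMono_nat_of_lt_succ fun j => by
    rw [hNsucc]; exact (Nat.lt_succ_self _).trans_le (le_max_left _ _)
  have hdisj : ∀ i j n, i ≠ j → v (N i) n = 0 ∨ v (N j) n = 0 := by
    have key : ∀ i j n, i < j → v (N i) n = 0 ∨ v (N j) n = 0 := fun i j n hij => by
      rcases lt_or_ge n (N j) with h | h
      · exact Or.inr ((hvS _).1 n h)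
      · refine Or.inl (hB _ n (le_trans ?_ h))
        exact (le_max_right _ _).trans ((hNsucc i).ge.trans (hNmono.monotone hij))
    intro i j n hij
    rcases hij.lt_or_gt with h | h
    · exact key i j n h
    · exact (key j i n h).symm
  refine ⟨fun j => (R : 𝕜)⁻¹ • T (v (N j)), fun j => ?_, fun φ hφ n a => ?_⟩
  · rw [norm_smul, norm_inv, RCLike.norm_ofReal, abs_of_pos hR0, inv_mul_le_iff₀ hR0, mul_one]
    exact hvR _
  · set w : EllOne 𝕜 := ∑ i ∈ Finset.range n, a i • v (N (φ i)) with hw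
    have hTw : ∑ i ∈ Finset.range n, a i • ((R : 𝕜)⁻¹ • T (v (N (φ i)))) = (R : 𝕜)⁻¹ • T w := by
      rw [hw, map_sum, Finset.smul_sum]
      refine Finset.sum_congr rfl fun i _ => ?_
      rw [map_smul, smul_comm]
    have hwn : ‖w‖ = ∑ i ∈ Finset.range n, ‖a i‖ := by
      rw [hw, EllOne.norm_sum_of_disjoint (u := fun i => a i • v (N (φ i)))]
      · exact Finset.sum_congr rfl fun i _ => by rw [norm_smul, hv1, mul_one]
      · intro i j k hij
        refine (hdisj (φ i) (φ j) k (hφ.injective.ne hij)).imp ?_ ?_ <;>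
        · intro h
          rw [lp.coeFn_smul, Pi.smul_apply, h, smul_zero]
    have hwS : ∀ i < m₀, w i = 0 := fun i hi => by
      rw [hw, lp.coeFn_sum, Finset.sum_apply]
      refine Finset.sum_eq_zero fun j _ => ?_
      rw [lp.coeFn_smul, Pi.smul_apply,
        (hvS (N (φ j))).1 i (hi.trans_le (hNmono.monotone (Nat.zero_le (φ j)))), smul_zero]
    have hwN : ∀ i, N (φ n) ≤ i → w i = 0 := fun i hi => by
      rw [hw, lp.coeFn_sum, Finset.sum_apply]
      refine Finset.sum_eq_zero fun j hj => ?_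
      rw [lp.coeFn_smul, Pi.smul_apply, hB (N (φ j)) i, smul_zero]
      refine (le_max_right _ _).trans ((hNsucc (φ j)).ge.trans
        ((hNmono.monotone (Nat.succ_le_of_lt ?_)).trans hi))
      exact hφ (Finset.mem_range.1 hj)
    have := ht w ⟨hwS, _, hwN⟩
    rw [hTw, norm_smul, norm_inv, RCLike.norm_ofReal, abs_of_pos hR0, ← hwn,
      le_inv_mul_iff₀ hR0, ← mul_assoc]
    refine le_trans (mul_le_mul_of_nonneg_right ?_ (norm_nonneg _)) this
    rw [hR]
    nlinarith [mul_pos hL0 hδ, mul_pos (mul_pos hL0 hδ) hδ]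

/-- The means of the first `n + 1` and the first `n + p + 1` terms differ by a combination of
`ℓ₁`-norm `2p / (n + p + 1)`, which tends to 2 as `p` grows. -/
lemma HasLowerEllOneEstimate.le_ccaTilde {q : ℝ} {y : ℕ → X}
    (hy : HasLowerEllOneEstimate 𝕜 q y) : ENNReal.ofReal (q * 2) ≤ ccaTilde 𝕜 y := by
  refine le_iInf₂ fun φ hφ => ofReal_le_ca fun n s hs => ?_
  have hlim : Tendsto (fun p : ℕ => q * (2 * (1 - ((n : ℝ) + 1) / ((p : ℝ) + ((n : ℝ) + 1)))))
      atTop (𝓝 (q * 2)) := by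
    have : Tendsto (fun p : ℕ => ((n : ℝ) + 1) / ((p : ℝ) + ((n : ℝ) + 1))) atTop (𝓝 0) :=
      tendsto_const_nhds.div_atTop
        (tendsto_atTop_add_const_right _ _ tendsto_natCast_atTop_atTop)
    simpa using ((this.const_sub 1).const_mul 2).const_mul q
  obtain ⟨p, hp⟩ := (hlim.eventually (lt_mem_nhds hs)).exists
  refine ⟨n, le_rfl, n + p, Nat.le_add_right n p, hp.le.trans ?_⟩
  set a : ℕ → ℝ := fun i => (if i < n + 1 then ((n : ℝ) + 1)⁻¹ else 0) -
    ((p : ℝ) + ((n : ℝ) + 1))⁻¹ with ha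
  have hn : (0 : ℝ) < (n : ℝ) + 1 := by positivity
  have hpn : (0 : ℝ) < (p : ℝ) + ((n : ℝ) + 1) := by positivity
  have hcard : n + p + 1 = (n + 1) + p := by omega
  have hsum : ∑ i ∈ Finset.range (n + p + 1), ‖((a i : ℝ) : 𝕜)‖ =
      2 * (1 - ((n : ℝ) + 1) / ((p : ℝ) + ((n : ℝ) + 1))) := by
    have h1 : ∀ i ∈ Finset.range (n + 1), ‖((a i : ℝ) : 𝕜)‖ =
        ((n : ℝ) + 1)⁻¹ - ((p : ℝ) + ((n : ℝ) + 1))⁻¹ := fun i hi => by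
      rw [RCLike.norm_ofReal, ha]
      simp only [if_pos (Finset.mem_range.1 hi)]
      exact abs_of_nonneg (sub_nonneg.2 (inv_anti₀ hn (by linarith [p.cast_nonneg (α := ℝ)])))
    have h2 : ∀ i ∈ Finset.range p, ‖((a (n + 1 + i) : ℝ) : 𝕜)‖ =
        ((p : ℝ) + ((n : ℝ) + 1))⁻¹ := fun i _ => by
      rw [RCLike.norm_ofReal, ha]
      simp only [if_neg (Nat.le_add_right (n + 1) i).not_gt, zero_sub, abs_neg]
      exact abs_of_pos (inv_pos.2 hpn)
    rw [hcard, Finset.sum_range_add, Finset.sum_congr rfl h1, Finset.sum_congr rfl h2]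
    simp only [Finset.sum_const, Finset.card_range, nsmul_eq_mul, Nat.cast_succ]
    field_simp
    ring
  have hmean : cesaroMeans 𝕜 (y ∘ φ) n - cesaroMeans 𝕜 (y ∘ φ) (n + p) =
      ∑ i ∈ Finset.range (n + p + 1), ((a i : ℝ) : 𝕜) • y (φ i) := by
    have h1 : ∑ i ∈ Finset.range (n + p + 1),
        (((if i < n + 1 then ((n : ℝ) + 1)⁻¹ else 0 : ℝ) : ℝ) : 𝕜) • y (φ i) =
        cesaroMeans 𝕜 (y ∘ φ) n := by
      rw [cesaroMeans, Finset.smul_sum, hcard, Finset.sum_range_add]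
      rw [Finset.sum_eq_zero (s := Finset.range p), add_zero]
      · refine Finset.sum_congr rfl fun i hi => ?_
        rw [if_pos (Finset.mem_range.1 hi)]
        simp
      · intro i _
        rw [if_neg (Nat.le_add_right (n + 1) i).not_gt]
        simp
    rw [← h1, cesaroMeans, Finset.smul_sum, ← Finset.sum_sub_distrib]
    refine Finset.sum_congr rfl fun i _ => ?_
    rw [ha, RCLike.ofReal_sub, sub_smul]
    congr 2
    push_cast
    congr 1
    ring
  have := hy φ hφ (n + p + 1) (fun i => ((a i : ℝ) : 𝕜))
  rwa [hsum, ← hmean] at this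

lemma bs_closedBall_eq_two (T : EllOne 𝕜 →L[𝕜] X) {c : ℝ} (hc : 0 < c)
    (hT : ∀ v, c * ‖v‖ ≤ ‖T v‖) : bs 𝕜 (Metric.closedBall (0 : X) 1) = 2 := by
  refine le_antisymm (bs_closedBall_le_two 𝕜) ?_
  have : ENNReal.ofReal 2 ≤ bs 𝕜 (Metric.closedBall (0 : X) 1) := by
    refine ofReal_le_bs 𝕜 fun r hr => ?_
    set m := max r 0 with hm
    have hm2 : m < 2 := max_lt hr two_pos
    have hm0 : 0 ≤ m := le_max_right _ _
    obtain ⟨y, hy1, hy⟩ := exists_hasLowerEllOneEstimate T hc hT (δ := (2 - m) / 4)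
      (by linarith)
    refine ⟨y, fun k => mem_closedBall_zero_iff.2 (hy1 k),
      (ENNReal.ofReal_le_ofReal ?_).trans hy.le_ccaTilde⟩
    linarith [le_max_left r 0]
  simpa using this

lemma bs_closedBall_of_containsEllOne (hX : ContainsEllOne 𝕜 X) :
    bs 𝕜 (Metric.closedBall (0 : X) 1) = 2 := by
  obtain ⟨Y, ⟨e⟩⟩ := hX
  set C := ‖(e.symm : Y →L[𝕜] EllOne 𝕜)‖ + 1 with hC
  have hC0 : 0 < C := by positivity
  refine bs_closedBall_eq_two (Y.subtypeL.comp (e : EllOne 𝕜 →L[𝕜] Y)) (inv_pos.2 hC0)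
    fun v => ?_
  rw [inv_mul_le_iff₀ hC0]
  have := (e.symm : Y →L[𝕜] EllOne 𝕜).le_opNorm (e v)
  rw [ContinuousLinearEquiv.coe_coe, e.symm_apply_apply] at this
  refine this.trans (mul_le_mul_of_nonneg_right ?_ (norm_nonneg _))
  rw [hC]; linarith

lemma bs_closedBall_ellOne : bs 𝕜 (Metric.closedBall (0 : EllOne 𝕜) 1) = 2 :=
  bs_closedBall_eq_two (ContinuousLinearMap.id 𝕜 _) one_pos fun v => by simp

/-- The functional on `ℓ₁` given by a sequence in the unit ball of `ℓ∞`. -/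
lemma exists_functional_of_bounded (f : ℕ → 𝕜) (hf : ∀ n, ‖f n‖ ≤ 1) :
    ∃ g : EllOne 𝕜 →L[𝕜] 𝕜, ∀ v : EllOne 𝕜, HasSum (fun n => f n * v n) (g v) := by
  have hle : ∀ (v : EllOne 𝕜) n, ‖f n * v n‖ ≤ ‖v n‖ := fun v n => by
    rw [norm_mul]; exact mul_le_of_le_one_left (norm_nonneg _) (hf n)
  have hs : ∀ v : EllOne 𝕜, Summable fun n => f n * v n := fun v =>
    Summable.of_norm_bounded (EllOne.hasSum_norm v).summable (hle v)
  refine ⟨LinearMap.mkContinuous ⟨⟨fun v => ∑' n, f n * v n, fun v w => ?_⟩, fun c v => ?_⟩ 1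
    fun v => ?_, fun v => (hs v).hasSum⟩
  · rw [← (hs v).tsum_add (hs w)]
    exact tsum_congr fun n => mul_add _ _ _
  · simp only [RingHom.id_apply, smul_eq_mul]
    rw [← tsum_mul_left]
    exact tsum_congr fun n => mul_left_comm _ _ _
  · rw [one_mul]
    exact tsum_of_norm_bounded (EllOne.hasSum_norm v) (hle v)

/-- Schur's property of `ℓ₁`, in the form that a weakly null sequence is not bounded away
from `0`. -/
lemma frequently_norm_le_of_weakly_null {z : ℕ → EllOne 𝕜}
    (hz : ∀ g : StrongDual 𝕜 (EllOne 𝕜), Tendsto (fun k => g (z k)) atTop (𝓝 0))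
    {δ : ℝ} (hδ : 0 < δ) : ∃ᶠ k in atTop, ‖z k‖ ≤ δ := by
  by_contra hfreq
  have hlarge : ∀ᶠ k in atTop, δ < ‖z k‖ := by
    simpa only [not_frequently, not_le] using hfreq
  have hcoord : ∀ n, Tendsto (fun k => ‖z k n‖) atTop (𝓝 0) := fun n => by
    obtain ⟨g, hg⟩ := exists_functional_of_bounded (𝕜 := 𝕜) (fun i => if i = n then 1 else 0)
      (fun i => by split_ifs <;> simp)
    have hgn : ∀ v : EllOne 𝕜, g v = v n := fun v => by
      refine (hg v).unique ?_
      have := hasSum_ite_eq n (v n)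
      refine this.congr_fun fun i => ?_
      split_ifs with h
      · rw [h, one_mul]
      · rw [zero_mul]
    have := (hz g).norm
    simpa only [hgn, norm_zero] using this
  obtain ⟨φ, N, hφ, hN, hN0, hj⟩ := exists_gliding_hump
    (H := fun N k => δ < ‖z k‖ ∧ ∑ n ∈ Finset.range N, ‖z k n‖ ≤ δ / 8)
    (T := fun N k => ‖z k‖ - δ / 8 ≤ ∑ n ∈ Finset.range N, ‖z k n‖)
    (fun N => hlarge.and (by
      have := tendsto_finsetSum (Finset.range N) fun n _ => hcoord n
      rw [Finset.sum_const_zero] at this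
      exact this.eventually (ge_mem_nhds (by positivity))))
    (fun k => (EllOne.hasSum_norm (z k)).tendsto_sum_nat.eventually
      (le_mem_nhds (by linarith)))
  have hex : ∀ n, ∃ j, n < N (j + 1) := fun n =>
    ⟨n, (Nat.lt_succ_self n).trans_le hN.le_apply⟩
  choose s hs1 hs using fun (j n : ℕ) => RCLike.exists_norm_eq_mul_self (z (φ j) n)
  -- On block `j` the functional carries the phases that make `z (φ j)` positive. Head and tail
  -- weigh at most `δ / 8` each, so `re (g (z (φ j)))` is at least `‖z (φ j)‖ - δ / 2`.
  obtain ⟨g, hg⟩ := exists_functional_of_bounded (fun n => s (Nat.find (hex n)) n)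
    (fun n => (hs1 _ n).le)
  have hfind : ∀ j, ∀ n ∈ Finset.Ico (N j) (N (j + 1)), Nat.find (hex n) = j := fun j n hn => by
    rw [Finset.mem_Ico] at hn
    refine (Nat.find_eq_iff _).2 ⟨hn.2, fun i hi => ?_⟩
    exact not_lt.2 ((hN.monotone hi).trans hn.1)
  have hge : ∀ j, δ / 2 ≤ RCLike.re (g (z (φ j))) := fun j => by
    have hre : HasSum (fun n => RCLike.re (s (Nat.find (hex n)) n * z (φ j) n))
        (RCLike.re (g (z (φ j)))) := (hg (z (φ j))).mapL RCLike.reCLM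
    have hind : HasSum (fun n => if n ∈ Finset.Ico (N j) (N (j + 1)) then ‖z (φ j) n‖ else 0)
        (∑ n ∈ Finset.Ico (N j) (N (j + 1)), ‖z (φ j) n‖) := by
      have : HasSum (fun n => if n ∈ Finset.Ico (N j) (N (j + 1)) then ‖z (φ j) n‖ else 0)
          (∑ n ∈ Finset.Ico (N j) (N (j + 1)),
            if n ∈ Finset.Ico (N j) (N (j + 1)) then ‖z (φ j) n‖ else 0) :=
        hasSum_sum_of_ne_finset_zero fun n hn => if_neg hn
      rwa [Finset.sum_congr rfl fun n hn => if_pos hn] at this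
    have hlow := (EllOne.hasSum_norm (z (φ j))).neg.add (hind.mul_left 2)
    have hle : -‖z (φ j)‖ + 2 * ∑ n ∈ Finset.Ico (N j) (N (j + 1)), ‖z (φ j) n‖ ≤
        RCLike.re (g (z (φ j))) := by
      refine hasSum_le (fun n => ?_) hlow hre
      by_cases hn : n ∈ Finset.Ico (N j) (N (j + 1))
      · rw [if_pos hn, hfind j n hn, ← hs, RCLike.ofReal_re]
        linarith
      · rw [if_neg hn, mul_zero, add_zero]
        have := RCLike.abs_re_le_norm (s (Nat.find (hex n)) n * z (φ j) n)
        rw [norm_mul, hs1, one_mul] at this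
        exact (abs_le.1 this).1
    have h1 := (hj j).1
    have h2 := (hj j).2
    rw [Finset.sum_Ico_eq_sub _ (hN.monotone (Nat.le_succ j))] at hle
    linarith [h1.1, h1.2]
  have hlim : Tendsto (fun j => RCLike.re (g (z (φ j)))) atTop (𝓝 0) := by
    have := (RCLike.continuous_re.tendsto (0 : 𝕜)).comp ((hz g).comp hφ.tendsto_atTop)
    simpa [Function.comp_def] using this
  have := ge_of_tendsto' hlim hge
  linarith

lemma wbs_closedBall_ellOne : wbs 𝕜 (Metric.closedBall (0 : EllOne 𝕜) 1) = 0 := by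
  refine wbs_eq_zero 𝕜 fun x hx a ha ε hε => ?_
  have hnull : ∀ g : StrongDual 𝕜 (EllOne 𝕜), Tendsto (fun k => g (x k - a)) atTop (𝓝 0) :=
    fun g => by
      have := (ha g).sub_const (g a)
      rw [sub_self] at this
      exact this.congr fun k => (map_sub _ _ _).symm
  obtain ⟨φ, hφ, h⟩ := extraction_of_frequently_atTop
    (frequently_norm_le_of_weakly_null hnull (half_pos hε))
  have := cca_le_of_norm_sub_le 𝕜 (x := x ∘ φ) h
  rw [mul_div_cancel₀ _ two_ne_zero] at this
  exact (ccaTilde_le_cca 𝕜 x hφ).trans this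

end EllOne

/-! ### Helly's theorem and James's sequences. -/

section Nonreflexive

variable {𝕜 : Type*} [RCLike 𝕜]

/-- Approximate version of Helly's theorem on the solvability of finite systems of linear
equations in the unit ball. -/
lemma exists_approx_solution {E : Type*} [NormedAddCommGroup E] [NormedSpace 𝕜 E]
    {ι : Type*} [Fintype ι] (f : ι → StrongDual 𝕜 E) (c : ι → 𝕜)
    (h : ∀ a : ι → 𝕜, ‖∑ i, a i * c i‖ ≤ ‖∑ i, a i • f i‖) {ε : ℝ} (hε : 0 < ε) :
    ∃ x : E, ‖x‖ ≤ 1 ∧ ∀ i, ‖f i x - c i‖ ≤ ε := by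
  classical
  set S : Set (ι → 𝕜) := (fun x i => f i x) '' Metric.closedBall (0 : E) 1 with hS
  by_cases hc : c ∈ closure S
  · obtain ⟨_, ⟨x, hx, rfl⟩, hxc⟩ := Metric.mem_closure_iff.1 hc ε hε
    refine ⟨x, by simpa using hx, fun i => ?_⟩
    rw [← dist_eq_norm, dist_comm]
    exact (dist_le_pi_dist c (fun i => f i x) i).trans hxc.le
  · exfalso
    have hconv : Convex ℝ S := by
      rintro _ ⟨x, hx, rfl⟩ _ ⟨y, hy, rfl⟩ s t hs ht hst
      refine ⟨(s : 𝕜) • x + (t : 𝕜) • y, ?_, ?_⟩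
      · rw [mem_closedBall_zero_iff] at hx hy ⊢
        refine (norm_add_le _ _).trans ?_
        rw [norm_smul, norm_smul, RCLike.norm_ofReal, RCLike.norm_ofReal, abs_of_nonneg hs,
          abs_of_nonneg ht]
        nlinarith
      · ext i
        simp [RCLike.real_smul_eq_coe_mul]
    -- The coefficients of a functional separating `c` from the image of the ball violate `h`.
    obtain ⟨g, u, hgu, huc⟩ := RCLike.geometric_hahn_banach_closed_point (𝕜 := 𝕜)
      hconv.closure isClosed_closure hc
    set a : ι → 𝕜 := fun i => g (Pi.single i 1) with ha
    have hg : ∀ v, g v = ∑ i, a i * v i := fun v => by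
      conv_lhs => rw [pi_eq_sum_univ' v, map_sum]
      refine Finset.sum_congr rfl fun i _ => ?_
      rw [map_smul, smul_eq_mul, mul_comm]
    have hgf : ∀ x, (∑ i, a i • f i) x = g (fun i => f i x) := fun x => by
      rw [hg]; simp
    have hre : ∀ x : E, ‖x‖ ≤ 1 → RCLike.re ((∑ i, a i • f i) x) < u := fun x hx => by
      rw [hgf]
      exact hgu _ (subset_closure ⟨x, by simpa using hx, rfl⟩)
    have hu : 0 ≤ u := by simpa using (hre 0 (by simp)).le
    have hnorm : ‖∑ i, a i • f i‖ ≤ u := by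
      refine ContinuousLinearMap.opNorm_le_of_unit_norm hu fun x hx => ?_
      -- Rotating `x` by a unimodular scalar turns the bound on real parts into one on norms.
      obtain ⟨s, hs, hsx⟩ := RCLike.exists_norm_eq_mul_self ((∑ i, a i • f i) x)
      have := hre (s • x) (by rw [norm_smul, hs, hx, one_mul])
      rw [map_smul, smul_eq_mul, ← hsx, RCLike.ofReal_re] at this
      exact this.le
    have := (RCLike.re_le_norm (g c)).trans ((hg c ▸ h a).trans hnorm)
    exact absurd huc this.not_gt

variable {X : Type*} [NormedAddCommGroup X] [NormedSpace 𝕜 X] [CompleteSpace X]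

lemma exists_far_from_range {E : Type*} [NormedAddCommGroup E] [NormedSpace 𝕜 E]
    (J₀ : X → E) (hadd : ∀ x y, J₀ (x + y) = J₀ x + J₀ y)
    (hsmul : ∀ (c : 𝕜) x, J₀ (c • x) = c • J₀ x) (hnorm : ∀ x, ‖J₀ x‖ = ‖x‖)
    (hsurj : ¬ Function.Surjective J₀) {θ : ℝ} (hθ : θ < 1) :
    ∃ F : E, ‖F‖ ≤ 1 ∧ ∀ (a : 𝕜) (x : X), ‖a‖ * θ ≤ ‖a • F + J₀ x‖ := by
  let J : X →ₗᵢ[𝕜] E := ⟨⟨⟨J₀, hadd⟩, hsmul⟩, hnorm⟩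
  change ∃ F : E, ‖F‖ ≤ 1 ∧ ∀ (a : 𝕜) (x : X), ‖a‖ * θ ≤ ‖a • F + J x‖
  have hclosed : IsClosed (LinearMap.range J.toLinearMap : Set E) :=
    J.isometry.isUniformInducing.isComplete_range.isClosed
  have hne : ∃ F : E, F ∉ LinearMap.range J.toLinearMap := by
    by_contra! hall
    exact hsurj fun F => hall F
  obtain ⟨F, hF, hdist⟩ := riesz_lemma hclosed hne hθ
  have hF0 : F ≠ 0 := by
    rintro rfl
    exact hF (Submodule.zero_mem _)
  have hFn : 0 < ‖F‖ := norm_pos_iff.2 hF0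
  have hF𝕜 : (‖F‖ : 𝕜) ≠ 0 := by exact_mod_cast hFn.ne'
  refine ⟨(‖F‖ : 𝕜)⁻¹ • F, ?_, fun a x => ?_⟩
  · rw [norm_smul, norm_inv, RCLike.norm_ofReal, abs_of_pos hFn, inv_mul_cancel₀ hFn.ne']
  · rcases eq_or_ne a 0 with rfl | ha
    · simp
    · have key := hdist (J (-((‖F‖ : 𝕜) / a) • x)) ⟨_, rfl⟩
      have heq : a • ((‖F‖ : 𝕜)⁻¹ • F) + J x =
          (a * (‖F‖ : 𝕜)⁻¹) • (F - J (-((‖F‖ : 𝕜) / a) • x)) := by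
        rw [map_smul, neg_smul, sub_neg_eq_add, smul_add, smul_smul, smul_smul,
          show a * (‖F‖ : 𝕜)⁻¹ * ((‖F‖ : 𝕜) / a) = 1 by field_simp, one_smul]
      rw [heq, norm_smul, norm_mul, norm_inv, RCLike.norm_ofReal, abs_of_pos hFn]
      calc ‖a‖ * θ = ‖a‖ * ‖F‖⁻¹ * (θ * ‖F‖) := by field_simp
        _ ≤ _ := by gcongr

/-- Riesz's lemma for the closed image of `X` in the bidual. For `θ ≥ 0` the inequality is Helly's
condition for the system `F g = θ`, `g x = 0` with `x` in a finite set. -/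
lemma exists_bidual_far_from_range (hX : ¬ Reflexive 𝕜 X) {θ : ℝ} (hθ : θ < 1) :
    ∃ F : StrongDual 𝕜 (StrongDual 𝕜 X), ‖F‖ ≤ 1 ∧ ∀ (a : 𝕜) (x : X),
      ‖a‖ * θ ≤ ‖a • F + NormedSpace.inclusionInDoubleDual 𝕜 X x‖ := by
  have hadd : ∀ x y : X, NormedSpace.inclusionInDoubleDual 𝕜 X (x + y) =
      NormedSpace.inclusionInDoubleDual 𝕜 X x + NormedSpace.inclusionInDoubleDual 𝕜 X y :=
    fun x y => map_add _ x y
  have hsmul : ∀ (c : 𝕜) (x : X), NormedSpace.inclusionInDoubleDual 𝕜 X (c • x) =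
      c • NormedSpace.inclusionInDoubleDual 𝕜 X x := fun c x => map_smul _ c x
  have hnorm : ∀ x : X, ‖NormedSpace.inclusionInDoubleDual 𝕜 X x‖ = ‖x‖ :=
    (NormedSpace.inclusionInDoubleDualLi 𝕜).norm_map
  refine exists_far_from_range (𝕜 := 𝕜) (X := X) (E := StrongDual 𝕜 (StrongDual 𝕜 X))
    (fun x => NormedSpace.inclusionInDoubleDual 𝕜 X x) ?_ ?_ ?_ ?_ hθ
  · exact hadd
  · exact hsmul
  · exact hnorm
  · exact hX

/-- James's sequences in a nonreflexive space. -/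
lemma exists_james_sequence (hX : ¬ Reflexive 𝕜 X) {θ ε : ℝ} (hθ0 : 0 ≤ θ) (hθ : θ < 1)
    (hε : 0 < ε) :
    ∃ (x : ℕ → X) (f : ℕ → StrongDual 𝕜 X), (∀ n, ‖x n‖ ≤ 1) ∧ (∀ n, ‖f n‖ ≤ 1) ∧
      (∀ m, ∀ k < m, ‖f m (x k)‖ ≤ ε) ∧ ∀ m k, m ≤ k → ‖f m (x k) - θ‖ ≤ 2 * ε := by
  classical
  obtain ⟨F, hF, hdist⟩ := exists_bidual_far_from_range hX hθ
  set J := NormedSpace.inclusionInDoubleDual 𝕜 X with hJ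
  obtain ⟨p, hp, hr⟩ := exists_seq_of_forall_finset_exists
    (fun p : X × StrongDual 𝕜 X => ‖p.1‖ ≤ 1 ∧ ‖p.2‖ ≤ 1 ∧ ‖F p.2 - θ‖ ≤ ε ∧
      ‖p.2 p.1 - θ‖ ≤ 2 * ε)
    (fun p q => ‖q.2 p.1‖ ≤ ε ∧ ‖p.2 q.1 - θ‖ ≤ 2 * ε) (fun s hs => by
      -- Helly in the dual gives `g` nearly vanishing on the earlier vectors with `F g` near `θ`.
      -- Helly in `X` then gives `y` imitating `F` on `g` and all earlier functionals; the two
      -- errors add up to `2 * ε`.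
      obtain ⟨g, hg1, hg⟩ := exists_approx_solution (𝕜 := 𝕜) (ι := Option s)
        (fun i => i.elim F fun p => J p.1.1) (fun i => i.elim (θ : 𝕜) fun _ => 0) (fun a => by
          simp only [Fintype.sum_option, Option.elim_none, Option.elim_some, mul_zero,
            Finset.sum_const_zero, add_zero]
          have := hdist (a none) (∑ p : s, a (some p) • p.1.1)
          rw [map_sum] at this
          simp only [map_smul] at this
          rwa [norm_mul, RCLike.norm_ofReal, abs_of_nonneg hθ0]) hε
      obtain ⟨y, hy1, hy⟩ := exists_approx_solution (𝕜 := 𝕜) (ι := Option s)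
        (fun i => i.elim g fun p => p.1.2) (fun i => F (i.elim g fun p => p.1.2)) (fun a => by
          have := F.le_of_opNorm_le hF (∑ i : Option s, a i • i.elim g fun p => p.1.2)
          rw [one_mul, map_sum] at this
          simpa only [map_smul, smul_eq_mul] using this) hε
      have htri : ∀ f : StrongDual 𝕜 X, ‖f y - F f‖ ≤ ε → ‖F f - θ‖ ≤ ε →
          ‖f y - θ‖ ≤ 2 * ε := fun f h1 h2 =>
        (norm_sub_le_norm_sub_add_norm_sub _ (F f) _).trans (by linarith)
      refine ⟨(y, g), ⟨hy1, hg1, hg none, htri g (hy none) (hg none)⟩, fun p hp => ⟨?_, ?_⟩⟩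
      · simpa [hJ] using hg (some ⟨p, hp⟩)
      · exact htri p.2 (hy (some ⟨p, hp⟩)) (hs p hp).2.2.1)
  refine ⟨fun n => (p n).1, fun n => (p n).2, fun n => (hp n).1, fun n => (hp n).2.1,
    fun m k hk => (hr k m hk).1, fun m k hk => ?_⟩
  rcases hk.eq_or_lt with rfl | hk
  · exact (hp m).2.2.2
  · exact (hr m k hk).2

lemma one_le_bs_closedBall_of_not_reflexive (hX : ¬ Reflexive 𝕜 X) :
    1 ≤ bs 𝕜 (Metric.closedBall (0 : X) 1) := by
  rw [← ENNReal.ofReal_one]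
  refine ofReal_le_bs 𝕜 fun r hr => ?_
  set m := max r 0 with hm
  have hm1 : m < 1 := max_lt hr one_pos
  have hm0 : 0 ≤ m := le_max_right _ _
  -- Chosen so that `θ - 4 * ε = m`; truncating `r` at 0 guarantees `0 ≤ θ`.
  obtain ⟨x, f, hx, hf, h0, hθ⟩ := exists_james_sequence (𝕜 := 𝕜) hX (θ := (1 + m) / 2)
    (ε := (1 - m) / 8) (by linarith) (by linarith) (by linarith)
  refine ⟨x, fun k => by simpa using hx k, (ENNReal.ofReal_le_ofReal ?_).trans
    (le_ccaTilde_of_functionals (α := (0 : 𝕜)) (β := (((1 + m) / 2 : ℝ) : 𝕜))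
      (ε := 2 * ((1 - m) / 8)) fun n => ⟨f n, fun v => ?_, fun k hk => ?_, hθ n⟩)⟩
  · rw [sub_zero, RCLike.norm_ofReal, abs_of_nonneg (by linarith)]
    linarith [le_max_left r 0]
  · simpa using (f n).le_of_opNorm_le (hf n) v
  · rw [sub_zero]
    exact (h0 n k hk).trans (by linarith)

end Nonreflexive

end BanachSaks

theorem theorem5p2 (𝕜 : Type*) [RCLike 𝕜] :
    ((∀ (X : Type*) [NormedAddCommGroup X] [NormedSpace 𝕜 X] [CompleteSpace X],
        BanachSaks.ContainsEllOne 𝕜 X →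
          BanachSaks.bs 𝕜 (Metric.closedBall (0 : X) 1) = 2) ∧
      BanachSaks.bs 𝕜 (Metric.closedBall (0 : BanachSaks.EllOne 𝕜) 1) = 2 ∧
      BanachSaks.wbs 𝕜 (Metric.closedBall (0 : BanachSaks.EllOne 𝕜) 1) = 0) ∧
    ((∀ (X : Type*) [NormedAddCommGroup X] [NormedSpace 𝕜 X] [CompleteSpace X],
        ¬ BanachSaks.Reflexive 𝕜 X → ¬ BanachSaks.ContainsEllOne 𝕜 X →
          BanachSaks.bs 𝕜 (Metric.closedBall (0 : X) 1) ∈ Set.Icc 1 2) ∧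
      BanachSaks.bs 𝕜 (Metric.closedBall (0 : BanachSaks.SeqCZero 𝕜) 1) = 1 ∧
      BanachSaks.bs 𝕜 (Metric.closedBall (0 : BanachSaks.seqC 𝕜) 1) = 2 ∧
      BanachSaks.wbs 𝕜 (Metric.closedBall (0 : BanachSaks.SeqCZero 𝕜) 1) = 0 ∧
      BanachSaks.wbs 𝕜 (Metric.closedBall (0 : BanachSaks.seqC 𝕜) 1) = 0) := by
  refine ⟨⟨fun X _ _ _ hX => BanachSaks.bs_closedBall_of_containsEllOne hX,
    BanachSaks.bs_closedBall_ellOne, BanachSaks.wbs_closedBall_ellOne⟩,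
    fun X _ _ _ hX _ => ⟨BanachSaks.one_le_bs_closedBall_of_not_reflexive hX,
      BanachSaks.bs_closedBall_le_two 𝕜⟩,
    le_antisymm BanachSaks.bs_closedBall_seqCZero_le BanachSaks.one_le_bs_closedBall_seqCZero,
    BanachSaks.bs_closedBall_seqC, BanachSaks.wbs_closedBall_seqCZero,
    BanachSaks.wbs_closedBall_seqC⟩
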